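/- Fix a finite set $K$ of $k\ge 2$ terminals. A (capacitated) graph is a finite undirected graph $G=(V,E)$ with $K\subseteq V$, not necessarily connected, with capacities $c:E\to\mathbb R_{\ge 0}$. A fractional packing problem $P$ on $K$ assigns to each graph $G$ (independently of $c$) a finite set $J_G$ of objects with values $p_j\ge 0$ and loads $A_{j,e}\ge 0$ ($j\in J_G$, $e\in E$); its fractional primal value is $$P(G,c)=\sup\Big\{\sum_j p_jx_j:\ x\ge 0,\ \sum_j A_{j,e}x_j\le c(e)\ \ \forall e\in E\Big\}.$$ The dual covering problem is to minimize $\sum_e c(e)\ell(e)$ over $\ell:E\to\mathbb R_{\ge0}$ with $\sum_e A_{j,e}\ell(e)\ge p_j$ for all $j$. $P$ is a *graph packing problem* if there is a monotone increasing function $F\ge 0$ of the semi-metrics on $K$ such that this dual is to minimize the total distance $\times$ capacity divided by $F$ of the distances between terminals; that is, for every graph $G$, every $\ell\ge 0$ and every $t\ge 0$, $$\sum_e A_{j,e}\ell(e)\ge t\,p_j\ \ \forall j\in J_G\iff \text{there is a semi-metric } d \text{ on } V \text{ with } d(u,v)\le \ell(uv)\ \ \forall uv\in E \text{ and } F(d|_K)\ge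 t .$$ (For connected $G$ the right-hand side says that $F$ of the shortest-path distances between terminals under $\ell$ is at least $t$.) A *notion of integrality* is a choice, for each finite $V\supseteq K$, of a class of admissible semi-metrics on $V$ (for example the cut metrics, or the partition metrics), such that if $\delta$ is admissible on $K$ and $f:V\to K$ satisfies $f(a)=a$ for all $a\in K$, then $(u,v)\mapsto\delta(f(u),f(v))$ is admissible on $V$. The integral dual value $ID(G,c)$ is the infimum of $\sum_{uv\in E}c(uv)\,d(u,v)\,/\,F(d|_K)$ over admissible $d$ on $V$ with $F(d|_K)>0$ ($+\infty$ if there are none). **Theorem.** There is an absolute constant $A>0$ such that for every $k\ge2$, every set $K$ of $k$ terminals, every graph packing problem $P$ on $K$ and every notion of integrality, $$\sup_{G,\,c}\frac{ID(G,c)}{P(G,c)}\ \le\ A\log k\cdot\sup_{T,\,c}\frac{ID(T,c)}{P(T,c)},$$ where $G$ ranges over all graphs containing $K$, $T$ over all trees with vertex set exactly $K$, and $c$ over all capacities. (Ratios $0/0$ and $\infty/\infty$ are not counted, $x/0=\infty$ for $x>0$, and $x/\infty=0$ for finite $x$.) -/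

import Mathlib

open scoped NNReal ENNReal

universe u

/-- A (finite-valued) semi-metric on `V`: distinct points may be at distance `0`. -/
@[ext] structure Semimetric (V : Type u) where
  dist : V → V → ℝ≥0
  dist_self : ∀ v, dist v v = 0
  dist_comm : ∀ v w, dist v w = dist w v
  dist_triangle : ∀ v w x, dist v x ≤ dist v w + dist w x

namespace Semimetric

/-- Semi-metrics are compared pointwise. -/
instance (V : Type u) : Preorder (Semimetric V) := Preorder.lift Semimetric.dist

/-- The pullback `(v, w) ↦ δ (f v) (f w)` of a semi-metric along a map. For an injection `f`
this is the restriction of the semi-metric to a subset. -/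
def comap {V W : Type u} (f : V → W) (δ : Semimetric W) : Semimetric V where
  dist v w := δ.dist (f v) (f w)
  dist_self v := δ.dist_self (f v)
  dist_comm v w := δ.dist_comm (f v) (f w)
  dist_triangle v w x := δ.dist_triangle (f v) (f w) (f x)

/-- The distance between the two ends of an unordered pair. -/
def onPair {V : Type u} (d : Semimetric V) (e : Sym2 V) : ℝ≥0 :=
  Sym2.lift ⟨d.dist, d.dist_comm⟩ e

end Semimetric

/-- A finite undirected graph (not necessarily connected) whose vertex set contains the
terminal set `K`. -/
structure TermGraph (K : Type u) where
  V : Type u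
  fintypeV : Fintype V
  graph : SimpleGraph V
  term : K ↪ V

namespace TermGraph

variable {K : Type u}

/-- The type of edges. -/
def Edge (N : TermGraph K) : Type u := {e : Sym2 N.V // e ∈ N.graph.edgeSet}

noncomputable instance (N : TermGraph K) : Fintype N.Edge :=
  haveI := N.fintypeV
  haveI : Finite N.Edge := inferInstanceAs (Finite {e : Sym2 N.V // e ∈ N.graph.edgeSet})
  Fintype.ofFinite _

/-- The length of an edge under a semi-metric on the vertices. -/
def edgeLen (N : TermGraph K) (d : Semimetric N.V) (e : N.Edge) : ℝ≥0 := d.onPair e.1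

/-- The total amount of distance `×` capacity, for edge capacities `c`. -/
noncomputable def cost (N : TermGraph K) (c : N.Edge → ℝ≥0) (d : Semimetric N.V) : ℝ≥0 :=
  ∑ e, c e * N.edgeLen d e

/-- A graph on the terminal set itself. -/
def onTerminals [Fintype K] (T : SimpleGraph K) : TermGraph K where
  V := K
  fintypeV := inferInstance
  graph := T
  term := Function.Embedding.refl K

end TermGraph

/-- A fractional packing problem with terminal set `K`. On every graph `N` there are finitely
many objects that can be packed; a unit of the object `j` has value `profit N j` and uses
`load N j e` units of the capacity of the edge `e`. -/
structure PackingProblem (K : Type u) where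
  Obj : TermGraph K → Type u
  fintypeObj : ∀ N, Fintype (Obj N)
  profit : ∀ N, Obj N → ℝ≥0
  load : ∀ N, Obj N → N.Edge → ℝ≥0

namespace PackingProblem

variable {K : Type u}

instance (P : PackingProblem K) (N : TermGraph K) : Fintype (P.Obj N) := P.fintypeObj N

/-- `x` is a feasible fractional packing in `N` for the capacities `c`. -/
def IsPacking (P : PackingProblem K) (N : TermGraph K) (c : N.Edge → ℝ≥0)
    (x : P.Obj N → ℝ≥0) : Prop :=
  ∀ e, ∑ j, x j * P.load N j e ≤ c e

/-- The optimum of the packing linear program: maximize `∑ x j * profit j` over the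
feasible fractional packings (`∞` if it is unbounded). -/
noncomputable def fracPrimal (P : PackingProblem K) (N : TermGraph K) (c : N.Edge → ℝ≥0) :
    ℝ≥0∞ :=
  ⨆ (x : P.Obj N → ℝ≥0) (_ : P.IsPacking N c x), ((∑ j, x j * P.profit N j : ℝ≥0) : ℝ≥0∞)

/-- The edge lengths `ℓ` cover every object at least `t` times its value. For `t = 1` these are
the constraints of the dual covering linear program (minimize `∑ c e * ℓ e`); for `t > 0` they
say that `ℓ / t` is feasible for it. -/
def Covers (P : PackingProblem K) (N : TermGraph K) (t : ℝ≥0) (ℓ : N.Edge → ℝ≥0) : Prop :=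
  ∀ j, t * P.profit N j ≤ ∑ e, P.load N j e * ℓ e

end PackingProblem

/-- A graph packing problem: a fractional packing problem whose dual covering problem is to
minimize the total distance `×` capacity divided by `F` of the distances between terminals, with
`F` a monotone increasing function of the semi-metric on the terminals.

That is: for edge lengths `ℓ`, the largest `t` for which `ℓ / t` is a feasible cover
is the value of `F` at the terminal distances under `ℓ`. In a connected graph the shortest-path
semi-metric is the largest semi-metric `d` with `d u v ≤ ℓ (u, v)` on all edges, so by
monotonicity the right-hand side of `covers_iff` says that `F` of the shortest-path distances
is at least `t`; in a disconnected graph the infinite distances are replaced by arbitrarily large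
finite ones. -/
structure GraphPackingProblem (K : Type u) extends PackingProblem K where
  F : Semimetric K → ℝ≥0
  monotone_F : Monotone F
  covers_iff : ∀ (N : TermGraph K) (ℓ : N.Edge → ℝ≥0) (t : ℝ≥0),
    toPackingProblem.Covers N t ℓ ↔
      ∃ d : Semimetric N.V, (∀ e, N.edgeLen d e ≤ ℓ e) ∧ t ≤ F (d.comap N.term)

/-- A notion of integrality: for every vertex set containing the terminals, a class of admissible
semi-metrics (such as all cut metrics, or all partition metrics), such that an admissible
semi-metric on the terminals stays admissible when each further vertex is placed
on top of a terminal. -/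
structure IntegralNotion (K : Type u) where
  Admissible : ∀ V : Type u, (K ↪ V) → Set (Semimetric V)
  comap_mem : ∀ (V : Type u) [Finite V] (term : K ↪ V) (f : V → K), (∀ a, f (term a) = a) →
    ∀ δ ∈ Admissible K (Function.Embedding.refl K), δ.comap f ∈ Admissible V term

namespace GraphPackingProblem

variable {K : Type u}

/-- The optimum of the integral dual: minimize the ratio of distance `×` capacity to `F` of the
terminal distances over the admissible semi-metrics for which `F` does not vanish
(`∞` if there are none). -/
noncomputable def intDual (P : GraphPackingProblem K) (I : IntegralNotion K) (N : TermGraph K)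
    (c : N.Edge → ℝ≥0) : ℝ≥0∞ :=
  ⨅ (d : Semimetric N.V) (_ : d ∈ I.Admissible N.V N.term) (_ : P.F (d.comap N.term) ≠ 0),
    (N.cost c d : ℝ≥0∞) / (P.F (d.comap N.term) : ℝ≥0∞)

/-- The worst-case ratio of the integral dual to the fractional primal, over all finite graphs
containing the terminals and all capacities. (Instances with ratio `0 / 0` or `∞ / ∞` do not count:
both quotients are `0`.) -/
noncomputable def gap (P : GraphPackingProblem K) (I : IntegralNotion K) : ℝ≥0∞ :=
  ⨆ (N : TermGraph K) (c : N.Edge → ℝ≥0), P.intDual I N c / P.fracPrimal N c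

/-- The worst-case ratio of the integral dual to the fractional primal over trees, namely
over all trees with vertex set `K` and all capacities. -/
noncomputable def treeGap [Fintype K] (P : GraphPackingProblem K) (I : IntegralNotion K) : ℝ≥0∞ :=
  ⨆ (T : SimpleGraph K) (_ : T.IsTree) (c : (TermGraph.onTerminals T).Edge → ℝ≥0),
    P.intDual I (TermGraph.onTerminals T) c / P.fracPrimal (TermGraph.onTerminals T) c

end GraphPackingProblem

/-! By linear programming duality a finite `P(G,c)` is at least the cost of some semi-metric `d` on
`V` with `F(d|_K) ≥ 1`. The aim is to replace `G` by a tree on `K` without losing much in the cost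
of `d` and without changing `F`.

Suppose `f : V → K` is a retraction, `T` a tree on `K`, and every edge `uv` of `G` is routed along a
walk in `T` from `f u` to `f v`. Let the capacity of a tree edge be the total capacity routed
through it. For every semi-metric `δ` on `K`, the cost of `δ` on `T` is then the capacity-weighted
length of the routing under `δ`. With `δ = d|_K`, weak duality bounds the fractional primal of `T`
by this length divided by `F(d|_K)`. With `δ` admissible, the pullback of `δ` along `f` is
admissible on `V`, has the same terminal distances and costs no more on `G` than `δ` on `T`, so the
integral dual of `G` is at most that of `T`. This is `intDual_le_of_routing`; only the length of the
routing under `d|_K` remains to be bounded.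

It is `O(log k)` times the cost of `d` for a suitable random tree (`exists_tree_routing`). At each
scale `r * 2 ^ l` a vertex joins the first terminal, in a random order, within distance `β * (r * 2
^ l)`. A terminal of rank `i` in distance from an edge can cut that edge only if it precedes the
closer ones, which has probability at most `1 / i`; for random `β` the expected scale at which it
cuts is at most the length of the edge. Summing over `i` gives the harmonic number. Intersecting the
partitions from the coarse scales down makes them laminar, and `exists_tree_of_laminar` contracts
the laminar family to a tree on the terminals. -/

/-! ### Linear programming duality. -/

/-- **Farkas' lemma**: a linear functional that is nonpositive wherever finitely many others are is
a nonnegative combination of them. -/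
theorem exists_nonneg_combination_of_nonpos {W ι : Type*} [AddCommGroup W] [Module ℝ W]
    [DecidableEq ι] (S : Finset ι) (a : ι → W →ₗ[ℝ] ℝ) (b : W →ₗ[ℝ] ℝ)
    (h : ∀ x, (∀ i ∈ S, a i x ≤ 0) → b x ≤ 0) :
    ∃ l : ι → ℝ, (∀ i, 0 ≤ l i) ∧ ∀ x, b x = ∑ i ∈ S, l i * a i x := by
  induction S using Finset.induction_on generalizing a b with
  | empty =>
    refine ⟨0, fun i => le_rfl, fun x => ?_⟩
    have h1 := h x (by simp)
    have h2 := h (-x) (by simp)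
    simp only [map_neg] at h2
    simp only [Finset.sum_empty]
    linarith
  | insert i₀ S hi₀ ih =>
    by_cases hS : ∀ x, (∀ i ∈ S, a i x ≤ 0) → b x ≤ 0
    · obtain ⟨l, hl, hb⟩ := ih a b hS
      refine ⟨fun i => if i = i₀ then 0 else l i, fun i => ?_, fun x => ?_⟩
      · dsimp only
        split_ifs
        exacts [le_rfl, hl i]
      · rw [Finset.sum_insert hi₀, hb x]
        simp only [if_true, zero_mul, zero_add]
        refine Finset.sum_congr rfl fun i hi => ?_
        rw [if_neg (by rintro rfl; exact hi₀ hi)]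
    · push Not at hS
      obtain ⟨y, hy, hby⟩ := hS
      have hay : 0 < a i₀ y := by
        by_contra hcon
        refine absurd (h y fun i hi => ?_) (not_le.2 hby)
        rcases Finset.mem_insert.1 hi with rfl | hi
        exacts [not_lt.1 hcon, hy i hi]
      -- `q` projects along `y` onto the kernel of `a i₀`. After composition with `q` the constraint
      -- `i₀` is void, so the induction hypothesis applies to the remaining ones.
      set q : W → W := fun x => x - (a i₀ x / a i₀ y) • y with hq
      have key : ∀ (g : W →ₗ[ℝ] ℝ) (x : W),
          (g - (g y / a i₀ y) • a i₀) x = g x - a i₀ x / a i₀ y * g y := by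
        intro g x
        simp only [LinearMap.sub_apply, LinearMap.smul_apply, smul_eq_mul]
        ring
      obtain ⟨l, hl, hb⟩ := ih (fun i => a i - (a i y / a i₀ y) • a i₀)
        (b - (b y / a i₀ y) • a i₀) (fun x hx => by
          have hgq : ∀ g : W →ₗ[ℝ] ℝ, g (q x) = (g - (g y / a i₀ y) • a i₀) x := by
            intro g
            rw [key]
            simp [hq]
          rw [← hgq]
          refine h _ fun i hi => ?_
          rcases Finset.mem_insert.1 hi with rfl | hi
          · rw [hgq, key, div_mul_cancel₀ _ hay.ne', sub_self]
          · rw [hgq]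
            exact hx i hi)
      have hsum : ∑ i ∈ S, l i * a i y ≤ 0 :=
        Finset.sum_nonpos fun i hi => mul_nonpos_of_nonneg_of_nonpos (hl i) (hy i hi)
      -- The new coefficient is forced by evaluating the identity at `y`; it is nonnegative because
      -- `b y > 0` while the other terms contribute at most `0` there.
      refine ⟨fun i => if i = i₀ then (b y - ∑ i ∈ S, l i * a i y) / a i₀ y else l i,
        fun i => ?_, fun x => ?_⟩
      · dsimp only
        split_ifs
        · exact div_nonneg (by linarith) hay.le
        · exact hl i
      · have hbx := hb x
        rw [key] at hbx
        simp only [key, mul_sub, Finset.sum_sub_distrib] at hbx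
        rw [Finset.sum_insert hi₀]
        dsimp only
        rw [if_pos rfl]
        have e1 : ∑ i ∈ S, (if i = i₀ then (b y - ∑ i ∈ S, l i * a i y) / a i₀ y else l i) * a i x
            = ∑ i ∈ S, l i * a i x :=
          Finset.sum_congr rfl fun i hi => by
            rw [if_neg (by rintro rfl; exact hi₀ hi)]
        have e2 : ∑ i ∈ S, l i * (a i₀ x / a i₀ y * a i y)
            = a i₀ x / a i₀ y * ∑ i ∈ S, l i * a i y := by
          rw [Finset.mul_sum]
          exact Finset.sum_congr rfl fun i _ => by ring
        rw [e1]
        rw [e2] at hbx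
        have e3 : (b y - ∑ i ∈ S, l i * a i y) / a i₀ y * a i₀ x
          = a i₀ x / a i₀ y * b y - a i₀ x / a i₀ y * ∑ i ∈ S, l i * a i y := by ring
        rw [e3]
        linarith

/-- **Strong duality** for packing linear programs: if every feasible packing has value at most
`M`, there is a feasible cover of cost at most `M`. -/
theorem exists_cover_of_packing_le {J E : Type*} [Fintype J] [Fintype E] (A : J → E → ℝ≥0)
    (p : J → ℝ≥0) (c : E → ℝ≥0) (M : ℝ≥0)
    (h : ∀ x : J → ℝ≥0, (∀ e, ∑ j, x j * A j e ≤ c e) → ∑ j, x j * p j ≤ M) :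
    ∃ l : E → ℝ≥0, (∀ j, p j ≤ ∑ e, A j e * l e) ∧ ∑ e, c e * l e ≤ M := by
  classical
  let lin (q : J → ℝ) (r : ℝ) : ((J → ℝ) × ℝ) →ₗ[ℝ] ℝ :=
    { toFun := fun y => ∑ j, y.1 j * q j + y.2 * r
      map_add' := fun y z => by
        simp only [Prod.fst_add, Prod.snd_add, Pi.add_apply, add_mul, Finset.sum_add_distrib]
        ring
      map_smul' := fun t y => by
        simp only [Prod.smul_fst, Prod.smul_snd, Pi.smul_apply, smul_eq_mul, RingHom.id_apply,
          mul_add, Finset.mul_sum, mul_assoc] }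
  have hlin : ∀ q r y, lin q r y = ∑ j, y.1 j * q j + y.2 * r := fun _ _ _ => rfl
  -- The program is homogenized by a scale `s`: capacities `s * c e`, `x ≥ 0`, `s ≥ 0`, and claim `∑
  -- x j * p j ≤ s * M`. The Farkas multipliers of the capacity constraints form the cover.
  let a : E ⊕ (J ⊕ Unit) → ((J → ℝ) × ℝ) →ₗ[ℝ] ℝ := Sum.elim (fun e => lin (fun j => A j e) (-c e))
    (Sum.elim (fun j => lin (Pi.single j (-1)) 0) (fun _ => lin 0 (-1)))
  obtain ⟨l, hl, hb⟩ := exists_nonneg_combination_of_nonpos Finset.univ a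
    (lin (fun j => p j) (-M)) (by
      rintro ⟨x, s⟩ hx
      have hE : ∀ e, ∑ j, x j * A j e ≤ s * c e := fun e => by
        have := hx (Sum.inl e) (Finset.mem_univ _)
        simp only [a, Sum.elim_inl, hlin] at this
        linarith
      have hJ : ∀ j, 0 ≤ x j := fun j => by
        have := hx (Sum.inr (Sum.inl j)) (Finset.mem_univ _)
        simpa [a, hlin, Pi.single_apply] using this
      have hs : 0 ≤ s := by
        have := hx (Sum.inr (Sum.inr ())) (Finset.mem_univ _)
        simpa [a, hlin] using this
      lift x to J → ℝ≥0 using hJ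
      lift s to ℝ≥0 using hs
      have hE' : ∀ e, ∑ j, x j * A j e ≤ s * c e := fun e => by
        have := hE e
        dsimp only at this
        exact_mod_cast this
      suffices ∑ j, x j * p j ≤ s * M by
        have h' : (∑ j, (x j : ℝ) * p j) ≤ s * M := by exact_mod_cast this
        rw [hlin]
        simp only
        linarith
      have hscale : ∀ t : ℝ≥0, t * s ≤ 1 → t * ∑ j, x j * p j ≤ M := fun t ht => by
        have := h (fun j => t * x j) fun e => by
          calc ∑ j, t * x j * A j e = t * ∑ j, x j * A j e := by
                rw [Finset.mul_sum]
                exact Finset.sum_congr rfl fun _ _ => mul_assoc _ _ _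
            _ ≤ t * (s * c e) := by gcongr; exact hE' e
            _ = (t * s) * c e := by ring
            _ ≤ 1 * c e := by gcongr
            _ = c e := one_mul _
        simpa only [Finset.mul_sum, mul_assoc] using this
      -- For `s = 0` every multiple of `x` is a packing, so a nonzero value would exceed `M` after
      -- scaling.
      rcases eq_or_ne s 0 with rfl | hs
      · simp only [zero_mul, nonpos_iff_eq_zero]
        by_contra hne
        have := hscale ((M + 1) / ∑ j, x j * p j) (by simp)
        rw [div_mul_cancel₀ _ hne] at this
        exact absurd this (not_le.2 (lt_add_one M))
      · have := hscale s⁻¹ (by rw [inv_mul_cancel₀ hs])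
        calc ∑ j, x j * p j = s * (s⁻¹ * ∑ j, x j * p j) := by
              rw [← mul_assoc, mul_inv_cancel₀ hs, one_mul]
          _ ≤ s * M := by gcongr)
  refine ⟨fun e => (l (Sum.inl e)).toNNReal, fun j => ?_, ?_⟩
  · have h1 := hb (Pi.single j 1, 0)
    simp only [hlin, a, Fintype.sum_sum_type, Sum.elim_inl, Sum.elim_inr] at h1
    simp [Pi.single_apply] at h1
    have h2 := hl (Sum.inr (Sum.inl j))
    rw [← NNReal.coe_le_coe]
    push_cast
    have : ∑ e, (A j e : ℝ) * l (Sum.inl e) = ∑ e, l (Sum.inl e) * (A j e : ℝ) :=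
      Finset.sum_congr rfl fun _ _ => mul_comm _ _
    simp only [Real.coe_toNNReal _ (hl _), this]
    linarith
  · have h1 := hb (0, 1)
    simp only [hlin, a, Fintype.sum_sum_type, Sum.elim_inl, Sum.elim_inr] at h1
    simp at h1
    have h2 := hl (Sum.inr (Sum.inr ()))
    rw [← NNReal.coe_le_coe]
    push_cast
    have : ∑ e, (c e : ℝ) * l (Sum.inl e) = ∑ e, l (Sum.inl e) * (c e : ℝ) :=
      Finset.sum_congr rfl fun _ _ => mul_comm _ _
    simp only [Real.coe_toNNReal _ (hl _), this]
    linarith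

/-! ### Trees on the terminals from laminar families. -/

/-- A parent function that decreases a linear order, except at the root, spans a tree. -/
theorem SimpleGraph.isTree_fromRel_parent {K : Type*} [Finite K] [LinearOrder K] (parent : K → K)
    (root : K) (hroot : parent root = root) (hlt : ∀ a, a ≠ root → parent a < a) :
    (SimpleGraph.fromRel fun a b => parent a = b).IsTree := by
  set T := SimpleGraph.fromRel fun a b => parent a = b with hT
  have hadj : ∀ a, a ≠ root → T.Adj a (parent a) := fun a ha =>
    (SimpleGraph.fromRel_adj _ _ _).2 ⟨(hlt a ha).ne', Or.inl rfl⟩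
  have hreach : ∀ a, T.Reachable a root := fun a => by
    induction a using (Finite.wellFounded_of_trans_of_irrefl (· < · : K → K → Prop)).induction with
    | _ a ih =>
      by_cases ha : a = root
      · rw [ha]
      · exact (hadj a ha).reachable.trans (ih _ (hlt a ha))
  have hconn : T.Connected :=
    { preconnected := fun a b => (hreach a).trans (hreach b).symm
      nonempty := ⟨root⟩ }
  rw [SimpleGraph.isTree_iff_connected_and_card]
  refine ⟨hconn, le_antisymm ?_ hconn.card_vert_le_card_edgeSet_add_one⟩
  -- Every edge joins a non-root to its parent, so a connected graph on `n` vertices has at most `n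
  -- - 1` edges.
  have hsub : T.edgeSet ⊆ (fun a => s(a, parent a)) '' {root}ᶜ := by
    intro e he
    induction e with
    | _ a b =>
      rw [SimpleGraph.mem_edgeSet, hT, SimpleGraph.fromRel_adj] at he
      obtain ⟨hne, rfl | rfl⟩ := he
      · exact ⟨a, fun h => hne (by rw [Set.mem_singleton_iff.1 h, hroot]), rfl⟩
      · exact ⟨b, fun h => hne (by rw [Set.mem_singleton_iff.1 h, hroot]), Sym2.eq_swap⟩
  have h1 : Nat.card T.edgeSet ≤ ({root}ᶜ : Set K).ncard :=
    (Set.ncard_le_ncard hsub (Set.toFinite _)).trans (Set.ncard_image_le (Set.toFinite _))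
  have h2 := Set.ncard_add_ncard_compl ({root} : Set K)
  rw [Set.ncard_singleton] at h2
  omega

/-- The length of a walk under a semi-metric. -/
noncomputable def SimpleGraph.Walk.semilength {K : Type u} {T : SimpleGraph K} (δ : Semimetric K)
    {a b : K} (w : T.Walk a b) : ℝ≥0 := (w.edges.map δ.onPair).sum

namespace SimpleGraph.Walk

variable {K : Type u} {T : SimpleGraph K} (δ : Semimetric K)

@[simp] theorem semilength_nil (a : K) : (nil : T.Walk a a).semilength δ = 0 := rfl

@[simp] theorem semilength_cons {a b x : K} (h : T.Adj a b) (w : T.Walk b x) :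
    (cons h w).semilength δ = δ.dist a b + w.semilength δ := by
  simp [semilength, Semimetric.onPair]

theorem semilength_append {a b x : K} (w : T.Walk a b) (w' : T.Walk b x) :
    (w.append w').semilength δ = w.semilength δ + w'.semilength δ := by
  simp [semilength]

theorem semilength_reverse {a b : K} (w : T.Walk a b) :
    w.reverse.semilength δ = w.semilength δ := by
  simp [semilength]

theorem dist_le_semilength {a b : K} (w : T.Walk a b) : δ.dist a b ≤ w.semilength δ := by
  induction w with
  | nil => simp [δ.dist_self]
  | cons h w ih =>
    rw [semilength_cons]
    exact (δ.dist_triangle _ _ _).trans (by gcongr)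

end SimpleGraph.Walk

open Classical in
/-- A laminar family of partitions of `V` that starts with the discrete and ends with the trivial
one gives a tree on the terminals and a retraction onto them, such that two points that are first
joined at level `i` are joined by a walk through clusters up to level `i`. -/
theorem exists_tree_of_laminar {K V : Type u} [Finite K] [Nonempty K] (τ : K ↪ V)
    (E : ℕ → Setoid V) (hE : Monotone E) (hE0 : E 0 = ⊥) (n : ℕ) (hEn : E n = ⊤)
    (δ : Semimetric K) (D : ℕ → ℝ≥0) (hD : ∀ j a b, E j (τ a) (τ b) → δ.dist a b ≤ D j) :
    ∃ (T : SimpleGraph K) (f : V → K), T.IsTree ∧ (∀ a, f (τ a) = a) ∧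
      ∀ u v, ∃ w : T.Walk (f u) (f v),
        w.semilength δ ≤ 2 * ∑ j ∈ Finset.range n, if E j u v then 0 else D (j + 1) := by
  cases nonempty_fintype K
  let _ : LinearOrder K := LinearOrder.lift' _ (Fintype.equivFin K).injective
  have hmin : ∀ S : Set K, ∃ a, S.Nonempty → a ∈ S ∧ ∀ b ∈ S, a ≤ b := fun S => by
    by_cases hS : S.Nonempty
    · obtain ⟨a, ha⟩ := S.toFinite.exists_minimal hS
      exact ⟨a, fun _ => ⟨ha.1, fun b hb => (le_total a b).elim id (ha.2 hb)⟩⟩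
    · exact ⟨Classical.arbitrary K, fun h => absurd h hS⟩
  choose m hm using hmin
  let S : ℕ → V → Set K := fun j v => {a | E j v (τ a)}
  have hSmono : ∀ v, Monotone fun j => S j v := fun v i j hij a ha => hE hij ha
  have hScongr : ∀ {j u v}, E j u v → S j u = S j v := fun {j u v} h => by
    ext a
    exact ⟨fun ha => (E j).trans ((E j).symm h) ha, fun ha => (E j).trans h ha⟩
  have hself : ∀ j a, a ∈ S j (τ a) := fun j a => (E j).refl _
  have hS0 : ∀ a, m (S 0 (τ a)) = a := fun a => by
    have h : E 0 (τ a) (τ (m (S 0 (τ a)))) := (hm (S 0 (τ a)) ⟨a, hself 0 a⟩).1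
    rw [hE0] at h
    exact (τ.injective h).symm
  have hSn : ∀ v, S n v = Set.univ := fun v =>
    Set.eq_univ_of_forall fun a => show E n v (τ a) by rw [hEn]; trivial
  set root := m Set.univ with hrootdef
  have hrootle : ∀ a, root ≤ a := fun a => (hm _ Set.univ_nonempty).2 a trivial
  -- The leader of a cluster is its least terminal. Clusters grow with the level, so a terminal that
  -- loses the lead never regains it; its parent is the leader that displaces it, which is smaller.
  have hpar : ∀ a, ∃ b, (a = root → b = a) ∧ (a ≠ root → b < a) ∧
      ∀ j, m (S j (τ a)) = a → m (S (j + 1) (τ a)) ≠ a → b = m (S (j + 1) (τ a)) := by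
    intro a
    have hlt : ∀ j, m (S (j + 1) (τ a)) ≠ a → m (S (j + 1) (τ a)) < a := fun j hj =>
      lt_of_le_of_ne ((hm _ ⟨a, hself _ a⟩).2 a (hself _ a)) hj
    by_cases hex : ∃ j, m (S j (τ a)) = a ∧ m (S (j + 1) (τ a)) ≠ a
    · obtain ⟨j, hj1, hj2⟩ := hex
      refine ⟨m (S (j + 1) (τ a)), fun h => ?_, fun _ => hlt j hj2, fun i hi1 hi2 => ?_⟩
      · exact absurd (hrootle (m (S (j + 1) (τ a)))) (not_le.2 (h ▸ hlt j hj2))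
      · have aux : ∀ i j, m (S j (τ a)) = a → m (S (i + 1) (τ a)) ≠ a → ¬ i < j := by
          intro i j hj hi hij
          have h1 : m (S (i + 1) (τ a)) ∈ S j (τ a) :=
            hSmono (τ a) (Nat.succ_le_of_lt hij) (hm _ ⟨a, hself _ a⟩).1
          have h2 := (hm _ ⟨a, hself j a⟩).2 _ h1
          rw [hj] at h2
          exact absurd h2 (not_le.2 (hlt i hi))
        have : i = j := le_antisymm (not_lt.1 (aux j i hi1 hj2)) (not_lt.1 (aux i j hj1 hi2))
        rw [this]
    · push Not at hex
      have hall : ∀ j, m (S j (τ a)) = a := fun j => by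
        induction j with
        | zero => exact hS0 a
        | succ j ih => exact hex j ih
      have har : a = root := by
        rw [hrootdef, ← hSn (τ a), hall n]
      exact ⟨a, fun _ => rfl, fun h => absurd har h, fun j _ h => absurd (hall (j + 1)) h⟩
  choose parent hp1 hp2 hp3 using hpar
  set T := SimpleGraph.fromRel fun a b => parent a = b with hT
  have hTree : T.IsTree :=
    SimpleGraph.isTree_fromRel_parent parent root (hp1 root rfl) hp2
  have hne : ∀ v, ∃ j, (S j v).Nonempty := fun v => ⟨n, by rw [hSn]; exact Set.univ_nonempty⟩
  -- `f v` is the leader of the first cluster around `v` that contains a terminal at all.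
  let q : V → ℕ := fun v => Nat.find (hne v)
  have hq : ∀ v, (S (q v) v).Nonempty := fun v => Nat.find_spec (hne v)
  let f : V → K := fun v => m (S (q v) v)
  -- Leaders of consecutive clusters around `v` coincide or are child and parent, and both lie in
  -- the cluster of level `j + 1`.
  have hstep : ∀ v j, (S j v).Nonempty →
      ∃ w : T.Walk (m (S j v)) (m (S (j + 1) v)), w.semilength δ ≤ D (j + 1) := by
    intro v j hj
    by_cases heq : m (S j v) = m (S (j + 1) v)
    · rw [← heq]
      exact ⟨SimpleGraph.Walk.nil, by simp⟩
    · set a := m (S j v) with ha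
      have haj : E j v (τ a) := (hm _ hj).1
      have haj' : E (j + 1) v (τ a) := hE (Nat.le_succ j) haj
      have hS1 := hScongr haj
      have hS2 := hScongr haj'
      have hpa : parent a = m (S (j + 1) v) := by
        rw [hS2]
        refine hp3 a j (by rw [← hS1]) ?_
        rw [← hS2]
        exact fun h => heq h.symm
      have hadj : T.Adj a (m (S (j + 1) v)) :=
        (SimpleGraph.fromRel_adj _ _ _).2 ⟨heq, Or.inl hpa⟩
      refine ⟨SimpleGraph.Walk.cons hadj .nil, ?_⟩
      simp only [SimpleGraph.Walk.semilength_cons, SimpleGraph.Walk.semilength_nil, add_zero]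
      refine hD _ _ _ ?_
      exact (E (j + 1)).trans ((E (j + 1)).symm haj') (hm _ (hj.mono (hSmono v (Nat.le_succ j)))).1
  have hwalk : ∀ v i, q v ≤ i → ∃ w : T.Walk (f v) (m (S i v)),
      w.semilength δ ≤ ∑ j ∈ Finset.range i, D (j + 1) := by
    intro v i hi
    induction i, hi using Nat.le_induction with
    | base => exact ⟨.nil, by simp⟩
    | succ i hi ih =>
      obtain ⟨w, hw⟩ := ih
      obtain ⟨w', hw'⟩ := hstep v i ((hq v).mono (hSmono v hi))
      refine ⟨w.append w', ?_⟩
      rw [SimpleGraph.Walk.semilength_append, Finset.sum_range_succ]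
      gcongr
  refine ⟨T, f, hTree, fun a => ?_, fun u v => ?_⟩
  · have : q (τ a) = 0 := by
      simp only [q, Nat.find_eq_zero]
      exact ⟨a, hself 0 a⟩
    simp only [f, this, hS0]
  · have hex : ∃ i, E i u v := ⟨n, by rw [hEn]; trivial⟩
    set i := Nat.find hex with hi
    have hiE : E i u v := Nat.find_spec hex
    have hin : i ≤ n := Nat.find_min' hex (by rw [hEn]; trivial)
    by_cases hSi : (S i u).Nonempty
    · obtain ⟨w, hw⟩ := hwalk u i (Nat.find_min' (hne u) hSi)
      obtain ⟨w', hw'⟩ := hwalk v i (Nat.find_min' (hne v) (hScongr hiE ▸ hSi))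
      have hmm : m (S i v) = m (S i u) := by rw [hScongr hiE]
      refine ⟨w.append (w'.copy rfl hmm).reverse, ?_⟩
      have hcopy : (w'.copy rfl hmm).semilength δ = w'.semilength δ := by
        simp [SimpleGraph.Walk.semilength]
      rw [SimpleGraph.Walk.semilength_append, SimpleGraph.Walk.semilength_reverse, hcopy, two_mul]
      have hsum : ∑ j ∈ Finset.range i, D (j + 1)
          ≤ ∑ j ∈ Finset.range n, if E j u v then 0 else D (j + 1) := by
        calc ∑ j ∈ Finset.range i, D (j + 1)
            = ∑ j ∈ Finset.range i, if E j u v then 0 else D (j + 1) :=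
              Finset.sum_congr rfl fun j hj => by
                rw [if_neg (Nat.find_min hex (Finset.mem_range.1 hj))]
          _ ≤ _ := Finset.sum_le_sum_of_subset (Finset.range_mono hin)
      exact add_le_add (hw.trans hsum) (hw'.trans hsum)
    -- If the cluster that joins `u` and `v` has no terminal, both first meet one in the same later
    -- cluster, so `f u = f v`.
    · have hlt : ∀ x, S i x = S i u → i < q x := fun x hx => by
        by_contra hcon
        exact hSi (hx ▸ (hq x).mono (hSmono x (not_lt.1 hcon)))
      have hcong : ∀ j, i ≤ j → S j u = S j v := fun j hj => hScongr (hE hj hiE)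
      have hqq : q u = q v := by
        refine le_antisymm (Nat.find_min' _ ?_) (Nat.find_min' _ ?_)
        · rw [hcong _ (hlt v (hcong i le_rfl).symm).le]
          exact hq v
        · rw [← hcong _ (hlt u rfl).le]
          exact hq u
      have hfuv : f u = f v := by
        simp only [f]
        rw [hqq, hcong _ (hlt v (hcong i le_rfl).symm).le]
      rw [hfuv]
      exact ⟨.nil, by simp⟩

/-! ### Transfer of the gap along a routing in a tree. -/

/-- An edge of a graph on the terminals, as an unordered pair of terminals. -/
def TermGraph.terminalPair {K : Type u} [Fintype K] {T : SimpleGraph K}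
    (x : (TermGraph.onTerminals T).Edge) : Sym2 K := x.1

/-- Grouping the entries of a list of edges by multiplicity. It turns the length of a routing into a
cost on the tree, with the multiplicities as capacities. -/
theorem SimpleGraph.sum_edge_count_mul {K : Type u} [Fintype K] [DecidableEq K]
    (T : SimpleGraph K) (φ : Sym2 K → ℝ≥0) (L : List (Sym2 K)) (hL : ∀ x ∈ L, x ∈ T.edgeSet) :
    ∑ x : (TermGraph.onTerminals T).Edge, (L.count (TermGraph.terminalPair x) : ℝ≥0) * φ (TermGraph.terminalPair x) = (L.map φ).sum := by
  classical
  induction L with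
  | nil => simp
  | cons y L ih =>
    rw [List.map_cons, List.sum_cons, ← ih fun x hx => hL x (List.mem_cons_of_mem _ hx)]
    let y' : (TermGraph.onTerminals T).Edge := ⟨y, hL y List.mem_cons_self⟩
    have hy' : TermGraph.terminalPair y' = y := rfl
    rw [← Finset.sum_erase_add _ _ (Finset.mem_univ y'),
      ← Finset.sum_erase_add _ _ (Finset.mem_univ y')]
    have h1 : ((y :: L).count (TermGraph.terminalPair y') : ℝ≥0) = L.count y + 1 := by
      rw [hy', List.count_cons_self]
      push_cast
      rfl
    have h2 : ∀ x ∈ Finset.univ.erase y', ((y :: L).count (TermGraph.terminalPair x) : ℝ≥0) *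
          φ (TermGraph.terminalPair x)
        = (L.count (TermGraph.terminalPair x) : ℝ≥0) * φ (TermGraph.terminalPair x) := fun x hx => by
      rw [List.count_cons_of_ne]
      exact fun h => Finset.ne_of_mem_erase hx (Subtype.ext h.symm)
    rw [h1, Finset.sum_congr rfl h2]
    rw [hy']
    ring

namespace GraphPackingProblem

variable {K : Type u} (P : GraphPackingProblem K) (I : IntegralNotion K)

/-- Weak duality: the cost of any semi-metric with `F ≠ 0` bounds the fractional packings. -/
theorem fracPrimal_le (N : TermGraph K) (c : N.Edge → ℝ≥0) (d : Semimetric N.V)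
    (hF : P.F (d.comap N.term) ≠ 0) :
    P.fracPrimal N c ≤ ((N.cost c d / P.F (d.comap N.term) : ℝ≥0) : ℝ≥0∞) := by
  refine iSup₂_le fun x hx => ?_
  rw [ENNReal.coe_le_coe, le_div_iff₀ (pos_iff_ne_zero.2 hF)]
  have hcov := (P.covers_iff N (N.edgeLen d) (P.F (d.comap N.term))).2
    ⟨d, fun _ => le_rfl, le_rfl⟩
  calc (∑ j, x j * P.profit N j) * P.F (d.comap N.term)
      = ∑ j, x j * (P.F (d.comap N.term) * P.profit N j) := by
        rw [Finset.sum_mul]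
        exact Finset.sum_congr rfl fun _ _ => by ring
    _ ≤ ∑ j, x j * ∑ e, P.load N j e * N.edgeLen d e := by
        gcongr with j
        exact hcov j
    _ = ∑ e, (∑ j, x j * P.load N j e) * N.edgeLen d e := by
        simp only [Finset.mul_sum, Finset.sum_mul, mul_assoc]
        exact Finset.sum_comm
    _ ≤ N.cost c d := by
        unfold TermGraph.cost
        gcongr with e
        exact hx e

/-- Strong duality: a finite fractional optimum is the cost of a semi-metric with `F ≥ 1`. -/
theorem exists_semimetric_of_fracPrimal_ne_top (N : TermGraph K) (c : N.Edge → ℝ≥0)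
    (h : P.fracPrimal N c ≠ ∞) :
    ∃ d : Semimetric N.V, 1 ≤ P.F (d.comap N.term) ∧ (N.cost c d : ℝ≥0∞) ≤ P.fracPrimal N c := by
  lift P.fracPrimal N c to ℝ≥0 using h with M hM
  obtain ⟨l, hl, hlM⟩ := exists_cover_of_packing_le (P.load N) (P.profit N) c M fun x hx => by
    rw [← ENNReal.coe_le_coe, hM]
    exact le_iSup₂_of_le (f := fun (x : P.Obj N → ℝ≥0) (_ : P.IsPacking N c x) =>
      ((∑ j, x j * P.profit N j : ℝ≥0) : ℝ≥0∞)) x hx le_rfl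
  obtain ⟨d, hd, hF⟩ := (P.covers_iff N l 1).1 fun j => by rw [one_mul]; exact hl j
  refine ⟨d, hF, ENNReal.coe_le_coe.2 (le_trans ?_ hlM)⟩
  unfold TermGraph.cost
  gcongr with e
  exact hd e

/-- If the edges of `N` are routed, after a retraction of the vertices onto the terminals, through
a tree on the terminals, the integral dual on `N` is bounded by that on the tree. -/
theorem intDual_le_of_routing [Fintype K] (N : TermGraph K) (c : N.Edge → ℝ≥0)
    (d : Semimetric N.V) (hF : P.F (d.comap N.term) ≠ 0) (T : SimpleGraph K) (hT : T.IsTree)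
    (f : N.V → K) (hf : ∀ a, f (N.term a) = a) (htree : P.treeGap I ≠ ∞)
    (w : ∀ u v, T.Walk (f u) (f v)) :
    P.intDual I N c ≤ P.treeGap I * ((∑ e, c e * (w e.1.out.1 e.1.out.2).semilength
      (d.comap N.term) : ℝ≥0) / P.F (d.comap N.term) : ℝ≥0) := by
  classical
  have := N.fintypeV
  let TN := TermGraph.onTerminals T
  let L : N.Edge → List (Sym2 K) := fun e => (w e.1.out.1 e.1.out.2).edges
  have hL : ∀ e, ∀ x ∈ L e, x ∈ T.edgeSet := fun e x hx =>
    SimpleGraph.Walk.edges_subset_edgeSet _ hx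
  let cT : TN.Edge → ℝ≥0 := fun x => ∑ e, c e * (L e).count (TermGraph.terminalPair x)
  have hcost : ∀ δ : Semimetric K, TN.cost cT δ
      = ∑ e, c e * (w e.1.out.1 e.1.out.2).semilength δ := fun δ => by
    unfold TermGraph.cost
    simp only [cT, Finset.sum_mul]
    rw [Finset.sum_comm]
    refine Finset.sum_congr rfl fun e _ => ?_
    rw [SimpleGraph.Walk.semilength, ← T.sum_edge_count_mul _ _ (hL e), Finset.mul_sum]
    exact Finset.sum_congr rfl fun x _ => mul_assoc _ _ _
  have hprimal : P.fracPrimal TN cT ≤ ((∑ e, c e * (w e.1.out.1 e.1.out.2).semilength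
      (d.comap N.term) : ℝ≥0) / P.F (d.comap N.term) : ℝ≥0) := by
    rw [← hcost]
    exact P.fracPrimal_le TN cT (d.comap N.term) hF
  have hdual : P.intDual I TN cT ≤ P.treeGap I * P.fracPrimal TN cT := by
    have h1 : P.intDual I TN cT / P.fracPrimal TN cT ≤ P.treeGap I :=
      le_iSup_of_le T (le_iSup₂_of_le (f := fun (_ : T.IsTree) (c : TN.Edge → ℝ≥0) =>
        P.intDual I TN c / P.fracPrimal TN c) hT cT le_rfl)
    rw [ENNReal.div_le_iff_le_mul (Or.inr htree)
      (Or.inl (ne_top_of_le_ne_top ENNReal.coe_ne_top hprimal))] at h1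
    exact h1
  -- Pulling back along `f` keeps `F`, and the triangle inequality along each walk shows that the
  -- cost does not exceed that on the tree.
  have hpull : P.intDual I N c ≤ P.intDual I TN cT := by
    refine le_iInf₂ fun δ hδ => le_iInf fun hδF => ?_
    have hcomap : (δ.comap f).comap N.term = δ := by
      ext a b
      simp [Semimetric.comap, hf]
    have hmem : δ.comap f ∈ I.Admissible N.V N.term := I.comap_mem _ N.term f hf δ hδ
    refine (iInf₂_le_of_le (δ.comap f) hmem (iInf_le_of_le (by rw [hcomap]; exact hδF) le_rfl)).trans
      ?_
    rw [hcomap]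
    refine ENNReal.div_le_div_right (ENNReal.coe_le_coe.2 ?_) _
    refine le_trans ?_ (hcost δ).ge
    unfold TermGraph.cost
    gcongr with e
    refine le_trans (le_of_eq ?_) (SimpleGraph.Walk.dist_le_semilength δ _)
    unfold TermGraph.edgeLen
    conv_lhs => rw [← Quot.out_eq e.1]
    rfl
  exact hpull.trans (hdual.trans (by gcongr))

end GraphPackingProblem

/-! ### Random ball partitions. -/

open Finset in
/-- Among all enumerations of `K`, at most a `1 / #L` fraction puts a given element of `L` first
among `L`. -/
theorem card_first_mul_card_le {K : Type*} [Fintype K] [DecidableEq K] (L : Finset K) (t : K)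
    (ht : t ∈ L) :
    #{g : K ≃ Fin (Fintype.card K) | ∀ t' ∈ L, g t ≤ g t'} * #L
      ≤ Fintype.card (K ≃ Fin (Fintype.card K)) := by
  let A : K → Finset (K ≃ Fin (Fintype.card K)) := fun a => {g | ∀ t' ∈ L, g a ≤ g t'}
  -- Swapping `t` and `a` before enumerating turns "`t` first" into "`a` first"; these events are
  -- disjoint for distinct elements of `L`.
  have hcard : ∀ a ∈ L, #(A t) ≤ #(A a) := fun a ha => by
    refine card_le_card_of_injOn (fun g => (Equiv.swap t a).trans g) (fun g hg => ?_)
      fun g _ g' _ h => Equiv.ext fun x => ?_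
    · simp only [A, coe_filter, mem_univ, true_and, Set.mem_ofPred_eq] at hg ⊢
      intro t' ht'
      simp only [Equiv.trans_apply, Equiv.swap_apply_right]
      refine hg _ ?_
      rcases eq_or_ne t' t with rfl | h1
      · rwa [Equiv.swap_apply_left]
      rcases eq_or_ne t' a with rfl | h2
      · rwa [Equiv.swap_apply_right]
      · rwa [Equiv.swap_apply_of_ne_of_ne h1 h2]
    · have := Equiv.congr_fun h (Equiv.swap t a x)
      simpa using this
  have hdisj : (L : Set K).PairwiseDisjoint A := fun a ha b hb hab => by
    refine disjoint_left.2 fun g hga hgb => hab ?_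
    simp only [A, mem_filter, mem_univ, true_and] at hga hgb
    exact g.injective (le_antisymm (hga b hb) (hgb a ha))
  calc #(A t) * #L = ∑ _a ∈ L, #(A t) := by rw [sum_const, smul_eq_mul, mul_comm]
    _ ≤ ∑ a ∈ L, #(A a) := sum_le_sum hcard
    _ = #(L.biUnion A) := (card_biUnion hdisj).symm
    _ ≤ _ := card_le_univ _

open Finset in
/-- The inverse ranks of `n` elements add up to at most the `n`-th harmonic number. -/
theorem sum_inv_rank_le_harmonic {K : Type*} [DecidableEq K] (y : K → ℝ≥0) (S : Finset K) :
    ∑ t ∈ S, ((#{t' ∈ S | y t' ≤ y t} : ℝ≥0))⁻¹ ≤ ∑ i ∈ range #S, ((i : ℝ≥0) + 1)⁻¹ := by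
  induction hn : #S generalizing S with
  | zero => simp [card_eq_zero.1 hn]
  | succ n ih =>
    -- A maximal element has rank `n + 1`, and removing it can only lower the other ranks.
    obtain ⟨a, ha, hmax⟩ := S.exists_max_image y (card_pos.1 (by omega))
    have hcard : #(S.erase a) = n := by rw [card_erase_of_mem ha, hn]; rfl
    rw [← sum_erase_add _ _ ha, sum_range_succ]
    refine add_le_add (le_trans (sum_le_sum fun t ht => ?_) (ih _ hcard)) ?_
    · have hpos : 0 < #{t' ∈ S.erase a | y t' ≤ y t} := card_pos.2 ⟨t, by simpa using ht⟩
      have : #{t' ∈ S.erase a | y t' ≤ y t} ≤ #{t' ∈ S | y t' ≤ y t} :=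
        card_le_card (filter_subset_filter _ (erase_subset _ _))
      gcongr
    · rw [filter_true_of_mem hmax, hn]
      push_cast
      exact le_rfl

open MeasureTheory in
/-- For `β` uniform in `[1, 2)`, the expected total size of the scales `r * 2 ^ l` for which
`β * (r * 2 ^ l)` falls into the interval `[a, b)` is at most `b - a`. -/
theorem sum_scale_mul_volume_le (r : ℝ) (hr : 0 < r) (a b : ℝ) (n : ℕ) :
    ∑ l ∈ Finset.range n, ENNReal.ofReal (r * 2 ^ l) *
      volume.restrict (Set.Ico (1 : ℝ) 2) ((fun β => β * (r * 2 ^ l)) ⁻¹' Set.Ico a b)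
      ≤ ENNReal.ofReal (b - a) := by
  -- Substituting `β * (r * 2 ^ l)` absorbs the weight and leaves the part of `[a, b)` in a dyadic
  -- interval; these intervals are disjoint.
  let B : ℕ → Set ℝ := fun l => Set.Ico (r * 2 ^ l) (r * 2 ^ (l + 1)) ∩ Set.Ico a b
  have hterm : ∀ l, ENNReal.ofReal (r * 2 ^ l) *
      volume.restrict (Set.Ico (1 : ℝ) 2) ((fun β => β * (r * 2 ^ l)) ⁻¹' Set.Ico a b)
      = volume (B l) := fun l => by
    have hrl : 0 < r * 2 ^ l := by positivity
    rw [Measure.restrict_apply (measurableSet_Ico.preimage (by fun_prop))]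
    have : (fun β => β * (r * 2 ^ l)) ⁻¹' Set.Ico a b ∩ Set.Ico 1 2
        = (fun β => β * (r * 2 ^ l)) ⁻¹' B l := by
      ext β
      simp only [B, Set.mem_inter_iff, Set.mem_preimage, Set.mem_Ico]
      rw [le_mul_iff_one_le_left hrl, pow_succ', mul_left_comm r 2, mul_lt_mul_iff_left₀ hrl]
      tauto
    rw [this, Real.volume_preimage_mul_right hrl.ne', abs_of_pos (inv_pos.2 hrl), ← mul_assoc,
      ← ENNReal.ofReal_mul hrl.le, mul_inv_cancel₀ hrl.ne', ENNReal.ofReal_one, one_mul]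
  have hmono : Monotone fun l : ℕ => r * 2 ^ l := fun i j hij => by
    dsimp only
    gcongr
    norm_num
  calc _ = ∑ l ∈ Finset.range n, volume (B l) := Finset.sum_congr rfl fun l _ => hterm l
    _ = volume (⋃ l ∈ Finset.range n, B l) := by
        refine (measure_biUnion_finset (fun i _ j _ hij => ?_)
          fun l _ => measurableSet_Ico.inter measurableSet_Ico).symm
        exact ((hmono.pairwise_disjoint_on_Ico_succ hij).mono Set.inter_subset_left
          Set.inter_subset_left)
    _ ≤ volume (Set.Ico a b) := measure_mono (Set.iUnion₂_subset fun _ _ => Set.inter_subset_right)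
    _ = _ := Real.volume_Ico

/-- The index of the first point of `K` in the enumeration `g` at distance at most `R`, where `y`
gives the distances. -/
noncomputable def firstWithin {K : Type*} [Fintype K] (g : K ≃ Fin (Fintype.card K)) (R : ℝ)
    (y : K → ℝ≥0) : WithTop (Fin (Fintype.card K)) :=
  (Finset.univ.filter fun t => (y t : ℝ) ≤ R).inf fun t => (g t : WithTop (Fin (Fintype.card K)))

section FirstWithin

variable {K : Type*} [Fintype K] {g : K ≃ Fin (Fintype.card K)} {R : ℝ} {y z : K → ℝ≥0}

theorem firstWithin_le {t : K} (ht : y t ≤ R) : firstWithin g R y ≤ g t :=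
  Finset.inf_le (f := fun t => (g t : WithTop (Fin (Fintype.card K)))) (by simpa using ht)

/-- The value `⊤` marks the points with no centre within `R`, which all share one class. -/
theorem exists_of_firstWithin_ne_top (h : firstWithin g R y ≠ ⊤) :
    ∃ t, y t ≤ R ∧ firstWithin g R y = g t := by
  have hne : (Finset.univ.filter fun t => (y t : ℝ) ≤ R).Nonempty := by
    by_contra hcon
    rw [Finset.not_nonempty_iff_eq_empty] at hcon
    exact h (by rw [firstWithin, hcon, Finset.inf_empty])
  obtain ⟨t, ht, he⟩ := Finset.exists_mem_eq_inf _ hne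
    fun t => (g t : WithTop (Fin (Fintype.card K)))
  exact ⟨t, by simpa using ht, he⟩

/-- If two points have different first centres, the point that comes first cuts them. -/
theorem exists_cut_of_firstWithin_ne (h : firstWithin g R y ≠ firstWithin g R z) :
    ∃ t, ((min (y t) (z t) : ℝ≥0) : ℝ) ≤ R ∧ R < ((max (y t) (z t) : ℝ≥0) : ℝ) ∧
      ∀ t', min (y t') (z t') ≤ min (y t) (z t) → g t ≤ g t' := by
  wlog hlt : firstWithin g R y < firstWithin g R z generalizing y z
  · obtain ⟨t, h1, h2, h3⟩ := this h.symm (lt_of_le_of_ne (not_lt.1 hlt) h.symm)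
    refine ⟨t, by rwa [min_comm], by rwa [max_comm], fun t' ht' => h3 t' ?_⟩
    rwa [min_comm, min_comm (z t)]
  obtain ⟨t, ht, he⟩ := exists_of_firstWithin_ne_top hlt.ne_top
  have hz : R < z t := by
    by_contra hcon
    exact absurd (firstWithin_le (g := g) (not_lt.1 hcon)) (not_le.2 (he ▸ hlt))
  have hmin : ((min (y t) (z t) : ℝ≥0) : ℝ) ≤ R :=
    le_trans (NNReal.coe_le_coe.2 (min_le_left _ _)) ht
  refine ⟨t, hmin, hz.trans_le (NNReal.coe_le_coe.2 (le_max_right _ _)), fun t' ht' => ?_⟩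
  have ht'R := (NNReal.coe_le_coe.2 ht').trans hmin
  rw [← WithTop.coe_le_coe, ← he]
  rcases min_choice (y t') (z t') with h' | h' <;> rw [h'] at ht'R
  · exact firstWithin_le ht'R
  · exact hlt.le.trans (firstWithin_le ht'R)

end FirstWithin

open MeasureTheory Finset in
open Classical in
/-- **Random ball partitions at all scales**: some enumeration `g` of `K` and some `β` cut the given
pairs at a total weighted scale of at most the harmonic number of `K` times their weighted
distance. -/
theorem exists_firstWithin_cut_le {K ι : Type*} [Fintype K] [Fintype ι] (y z : ι → K → ℝ≥0)
    (δ c : ι → ℝ≥0) (hyz : ∀ e t, y e t ≤ z e t + δ e) (hzy : ∀ e t, z e t ≤ y e t + δ e)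
    (r : ℝ≥0) (hr : 0 < r) (n : ℕ) :
    ∃ (g : K ≃ Fin (Fintype.card K)) (β : ℝ), β ∈ Set.Ico (1 : ℝ) 2 ∧
      ∑ e, c e * ∑ l ∈ range n,
        (if firstWithin g (β * (r * 2 ^ l)) (y e) = firstWithin g (β * (r * 2 ^ l)) (z e) then 0
          else r * 2 ^ l)
      ≤ (∑ i ∈ range (Fintype.card K), ((i : ℝ≥0) + 1)⁻¹) * ∑ e, c e * δ e := by
  let G := K ≃ Fin (Fintype.card K)
  let H : ℝ≥0 := ∑ i ∈ range (Fintype.card K), ((i : ℝ≥0) + 1)⁻¹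
  let low : ι → K → ℝ≥0 := fun e t => min (y e t) (z e t)
  let high : ι → K → ℝ≥0 := fun e t => max (y e t) (z e t)
  let L : ι → K → Finset K := fun e t => {t' | low e t' ≤ low e t}
  let first : ι → K → Finset G := fun e t => {g | ∀ t' ∈ L e t, g t ≤ g t'}
  let B : ι → K → ℕ → Set ℝ := fun e t l =>
    (fun β => β * ((r : ℝ) * 2 ^ l)) ⁻¹' Set.Ico (low e t : ℝ) (high e t)
  have hBm : ∀ e t l, MeasurableSet (B e t l) := fun e t l =>
    measurableSet_Ico.preimage (by fun_prop)
  have hfirst : ∀ e, ∑ t, (#(first e t) : ℝ≥0) ≤ Fintype.card G * H := fun e => by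
    calc ∑ t, (#(first e t) : ℝ≥0) ≤ ∑ t, (Fintype.card G : ℝ≥0) * (#(L e t) : ℝ≥0)⁻¹ := by
          refine sum_le_sum fun t _ => ?_
          have ht : t ∈ L e t := by simp [L]
          have hpos : (0 : ℝ≥0) < #(L e t) := Nat.cast_pos.2 (card_pos.2 ⟨t, ht⟩)
          rw [← div_eq_mul_inv, le_div_iff₀ hpos]
          exact_mod_cast card_first_mul_card_le (L e t) t ht
      _ = Fintype.card G * ∑ t, (#(L e t) : ℝ≥0)⁻¹ := by rw [mul_sum]
      _ ≤ Fintype.card G * H := by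
          gcongr
          exact sum_inv_rank_le_harmonic (low e) univ
  -- `Ψ β` bounds the cut cost summed over all enumerations: `t` is charged when it is first among
  -- the terminals at most as far from the pair and its sphere of radius `β * (r * 2 ^ l)` separates
  -- the pair.
  let Ψ : ℝ → ℝ≥0∞ := fun β => ∑ e, (c e : ℝ≥0∞) * ∑ t, (#(first e t) : ℝ≥0∞) *
    ∑ l ∈ range n, ENNReal.ofReal (r * 2 ^ l) * (B e t l).indicator 1 β
  have hind : ∀ e t l, Measurable ((B e t l).indicator (1 : ℝ → ℝ≥0∞)) := fun e t l =>
    measurable_one.indicator (hBm e t l)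
  have hΨm : Measurable Ψ := by
    refine Finset.measurable_sum _ fun e _ => Measurable.const_mul ?_ _
    refine Finset.measurable_sum _ fun t _ => Measurable.const_mul ?_ _
    exact Finset.measurable_sum _ fun l _ => Measurable.const_mul (hind e t l) _
  have hint : ∫⁻ β in Set.Ico (1 : ℝ) 2, Ψ β ≤
      ((Fintype.card G * (H * ∑ e, c e * δ e) : ℝ≥0) : ℝ≥0∞) := by
    calc ∫⁻ β in Set.Ico (1 : ℝ) 2, Ψ β
        = ∑ e, (c e : ℝ≥0∞) * ∑ t, (#(first e t) : ℝ≥0∞) * ∑ l ∈ range n,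
          ENNReal.ofReal (r * 2 ^ l) * volume.restrict (Set.Ico (1 : ℝ) 2) (B e t l) := by
          rw [lintegral_finsetSum _ fun e _ => Measurable.const_mul (Finset.measurable_sum _
            fun t _ => Measurable.const_mul (Finset.measurable_sum _
              fun l _ => Measurable.const_mul (hind e t l) _) _) _]
          refine sum_congr rfl fun e _ => ?_
          rw [lintegral_const_mul _ (Finset.measurable_sum _
            fun t _ => Measurable.const_mul (Finset.measurable_sum _
              fun l _ => Measurable.const_mul (hind e t l) _) _),
            lintegral_finsetSum _ fun t _ => Measurable.const_mul (Finset.measurable_sum _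
              fun l _ => Measurable.const_mul (hind e t l) _) _]
          congr 1
          refine sum_congr rfl fun t _ => ?_
          rw [lintegral_const_mul _ (Finset.measurable_sum _
              fun l _ => Measurable.const_mul (hind e t l) _),
            lintegral_finsetSum _ fun l _ => Measurable.const_mul (hind e t l) _]
          congr 1
          refine sum_congr rfl fun l _ => ?_
          rw [lintegral_const_mul _ (hind e t l), lintegral_indicator_one (hBm e t l)]
      _ ≤ ∑ e, (c e : ℝ≥0∞) * ∑ t, (#(first e t) : ℝ≥0∞) * (δ e : ℝ≥0∞) := by
          gcongr with e _ t _
          refine (sum_scale_mul_volume_le r hr _ _ n).trans ?_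
          rw [ENNReal.ofReal_le_iff_le_toReal ENNReal.coe_ne_top, ENNReal.coe_toReal,
            sub_le_iff_le_add]
          have : high e t ≤ δ e + low e t := by
            rcases le_total (y e t) (z e t) with h | h
            · simp only [high, low, max_eq_right h, min_eq_left h]
              exact (hzy e t).trans_eq (add_comm _ _)
            · simp only [high, low, max_eq_left h, min_eq_right h]
              exact (hyz e t).trans_eq (add_comm _ _)
          exact_mod_cast this
      _ = ((∑ e, c e * ((∑ t, (#(first e t) : ℝ≥0)) * δ e) : ℝ≥0) : ℝ≥0∞) := by
          push_cast
          simp only [sum_mul]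
      _ ≤ _ := by
          rw [ENNReal.coe_le_coe]
          calc ∑ e, c e * ((∑ t, (#(first e t) : ℝ≥0)) * δ e)
              ≤ ∑ e, c e * ((Fintype.card G * H) * δ e) := by
                gcongr with e
                exact hfirst e
            _ = _ := by
                simp only [mul_sum]
                exact sum_congr rfl fun e _ => by ring
  obtain ⟨β, hβ, hβle⟩ := exists_le_setLAverage (μ := volume) (s := Set.Ico (1 : ℝ) 2) (f := Ψ)
    (by simp) (by simp) hΨm.aemeasurable
  have hvol : volume (Set.Ico (1 : ℝ) 2) = 1 := by
    rw [Real.volume_Ico]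
    norm_num
  rw [setLAverage_eq, hvol, div_one] at hβle
  let cutCost : G → ℝ≥0 := fun g => ∑ e, c e * ∑ l ∈ range n,
    (if firstWithin g (β * (r * 2 ^ l)) (y e) = firstWithin g (β * (r * 2 ^ l)) (z e) then 0
      else r * 2 ^ l)
  have hcut : ∀ e l (g : G), (if firstWithin g (β * (r * 2 ^ l)) (y e) =
      firstWithin g (β * (r * 2 ^ l)) (z e) then 0 else r * 2 ^ l) ≤
      ∑ t, if β ∈ B e t l ∧ g ∈ first e t then r * 2 ^ l else 0 := fun e l g => by
    split_ifs with h
    · exact zero_le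
    · obtain ⟨t, h1, h2, h3⟩ := exists_cut_of_firstWithin_ne h
      have hcond : β ∈ B e t l ∧ g ∈ first e t := by
        refine ⟨⟨h1, h2⟩, ?_⟩
        simp only [first, L, mem_filter, mem_univ, true_and]
        exact h3
      refine le_trans ?_ (single_le_sum (f := fun t =>
        if β ∈ B e t l ∧ g ∈ first e t then r * 2 ^ l else 0) (fun _ _ => zero_le) (mem_univ t))
      rw [if_pos hcond]
  have hΨ : ((∑ g, cutCost g : ℝ≥0) : ℝ≥0∞) ≤ Ψ β := by
    have hΨeq : Ψ β = ((∑ e, c e * ∑ t, (#(first e t) : ℝ≥0) * ∑ l ∈ range n,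
        (if β ∈ B e t l then r * 2 ^ l else 0) : ℝ≥0) : ℝ≥0∞) := by
      push_cast
      refine sum_congr rfl fun e _ => ?_
      congr 1
      refine sum_congr rfl fun t _ => ?_
      congr 1
      refine sum_congr rfl fun l _ => ?_
      have : ENNReal.ofReal ((r : ℝ) * 2 ^ l) = (r : ℝ≥0∞) * 2 ^ l := by
        rw [ENNReal.ofReal_mul r.coe_nonneg, ENNReal.ofReal_coe_nnreal,
          ENNReal.ofReal_pow (by norm_num), ENNReal.ofReal_ofNat]
      rw [this, Set.indicator_apply]
      split_ifs <;> simp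
    rw [hΨeq, ENNReal.coe_le_coe]
    calc ∑ g, cutCost g ≤ ∑ g, ∑ e, c e * ∑ l ∈ range n,
          ∑ t, (if β ∈ B e t l ∧ g ∈ first e t then r * 2 ^ l else 0) := by
          simp only [cutCost]
          gcongr
          exact hcut _ _ _
      _ = ∑ e, c e * ∑ t, ∑ l ∈ range n, ∑ g : G,
          (if β ∈ B e t l ∧ g ∈ first e t then r * 2 ^ l else 0) := by
          rw [sum_comm]
          refine sum_congr rfl fun e _ => ?_
          rw [← mul_sum]
          congr 1
          refine (sum_congr rfl fun g _ => sum_comm).trans ?_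
          rw [sum_comm]
          exact sum_congr rfl fun t _ => sum_comm
      _ = _ := by
          refine sum_congr rfl fun e _ => ?_
          congr 1
          refine sum_congr rfl fun t _ => ?_
          rw [mul_sum]
          refine sum_congr rfl fun l _ => ?_
          by_cases hb : β ∈ B e t l
          · simp [hb]
          · simp [hb]
  have htotal : ∑ g, cutCost g ≤ ∑ _g : G, H * ∑ e, c e * δ e := by
    rw [sum_const, card_univ, nsmul_eq_mul, ← ENNReal.coe_le_coe]
    exact hΨ.trans (hβle.trans hint)
  obtain ⟨g, _, hg⟩ := exists_le_of_sum_le ⟨Fintype.equivFin K, mem_univ _⟩ htotal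
  exact ⟨g, β, hβ, hg⟩

/-! ### The random tree and the cost of its routing. -/

open Classical in
/-- **Retraction onto a random tree**: for a semi-metric on a finite vertex set there are a tree on
the `k` terminals and a retraction of the vertices onto them, such that the given weighted pairs
are routed in the tree at a cost of `O(log k)` times their weighted distance. -/
theorem exists_tree_routing {K V : Type u} {ι : Type*} [Fintype K] [Nonempty K] [Finite V]
    [Fintype ι] (τ : K ↪ V) (d : Semimetric V) (u v : ι → V) (c : ι → ℝ≥0) :
    ∃ (T : SimpleGraph K) (f : V → K), T.IsTree ∧ (∀ a, f (τ a) = a) ∧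
      ∃ w : ∀ x y, T.Walk (f x) (f y),
        ∑ e, c e * (w (u e) (v e)).semilength (d.comap τ) ≤
          32 * ((∑ i ∈ Finset.range (Fintype.card K), ((i : ℝ≥0) + 1)⁻¹) *
            ∑ e, c e * d.dist (u e) (v e)) := by
  cases nonempty_fintype V
  -- So small that terminals sharing a centre at scale `0`, hence at distance at most `4 * r`, are
  -- at distance `0`.
  obtain ⟨r, hr, hrd⟩ : ∃ r : ℝ≥0, 0 < r ∧ ∀ x y, d.dist x y ≤ 4 * r → d.dist x y = 0 := by
    have hev : ∀ p : V × V, ∀ᶠ r : ℝ≥0 in nhdsWithin 0 (Set.Ioi 0),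
        d.dist p.1 p.2 ≤ 4 * r → d.dist p.1 p.2 = 0 := fun p => by
      rcases eq_or_ne (d.dist p.1 p.2) 0 with h | h
      · exact Filter.Eventually.of_forall fun _ _ => h
      · have : ∀ᶠ r : ℝ≥0 in nhds 0, 4 * r < d.dist p.1 p.2 :=
          (Continuous.tendsto' (f := fun r : ℝ≥0 => 4 * r) (by fun_prop) 0 0
            (mul_zero _)).eventually_lt_const (pos_iff_ne_zero.2 h)
        filter_upwards [nhdsWithin_le_nhds this] with r hr hle
        exact absurd hle (not_le.2 hr)
    obtain ⟨r, h1, h2⟩ := ((Filter.eventually_all.2 hev).and self_mem_nhdsWithin).exists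
    exact ⟨r, h2, fun x y => h1 (x, y)⟩
  obtain ⟨n, hn⟩ : ∃ n : ℕ, ∀ x y, d.dist x y ≤ r * 2 ^ n := by
    obtain ⟨n, hn⟩ := pow_unbounded_of_one_lt ((∑ p : V × V, d.dist p.1 p.2) / r)
      (one_lt_two : (1 : ℝ≥0) < 2)
    refine ⟨n, fun x y => ?_⟩
    rw [div_lt_iff₀ hr, mul_comm] at hn
    exact (Finset.single_le_sum (f := fun p : V × V => d.dist p.1 p.2) (fun _ _ => zero_le)
      (Finset.mem_univ (x, y))).trans hn.le
  let dt : V → K → ℝ≥0 := fun x t => d.dist x (τ t)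
  obtain ⟨g, β, hβ, hcut⟩ := exists_firstWithin_cut_le (fun e => dt (u e)) (fun e => dt (v e))
    (fun e => d.dist (u e) (v e)) c
    (fun e t => by
      rw [add_comm]
      exact d.dist_triangle _ _ _)
    (fun e t => by
      rw [add_comm, d.dist_comm (u e)]
      exact d.dist_triangle _ _ _) r hr n
  let F : ℕ → V → WithTop (Fin (Fintype.card K)) := fun l x =>
    firstWithin g (β * (r * 2 ^ l)) (dt x)
  -- Level `j + 1` is the common refinement of all ball partitions at scales `l ≥ j`; the shift
  -- leaves level `0` for the discrete partition.
  let E : ℕ → Setoid V := fun j => match j with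
    | 0 => ⊥
    | j + 1 => ⟨fun x y => ∀ l, j ≤ l → F l x = F l y, fun _ _ _ => rfl,
        fun h l hl => (h l hl).symm, fun h h' l hl => (h l hl).trans (h' l hl)⟩
  have hEsucc : ∀ j x y, E (j + 1) x y ↔ ∀ l, j ≤ l → F l x = F l y := fun _ _ _ => Iff.rfl
  have hE : Monotone E := monotone_nat_of_le_succ fun j => by
    cases j with
    | zero => exact bot_le
    | succ j => exact fun x y h l hl => h l (by omega)
  let t₀ : K := g.symm ⟨0, Fintype.card_pos⟩
  have hfar : ∀ l, n ≤ l → ∀ x, F l x = g t₀ := fun l hl x => by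
    have hle : (dt x t₀ : ℝ) ≤ β * (r * 2 ^ l) := by
      have h1 : (dt x t₀ : ℝ) ≤ r * 2 ^ l := by
        have : dt x t₀ ≤ r * 2 ^ l := (hn _ _).trans (by gcongr; norm_num)
        exact_mod_cast this
      exact h1.trans (le_mul_of_one_le_left (by positivity) hβ.1)
    refine le_antisymm (firstWithin_le hle) ?_
    refine Finset.le_inf fun t _ => WithTop.coe_le_coe.2 ?_
    simp [t₀]
  have hEn : E (n + 1) = ⊤ := by
    ext x y
    rw [hEsucc]
    exact ⟨fun _ => trivial, fun _ l hl => by rw [hfar l hl, hfar l hl]⟩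
  -- Bounds on terminal distances within a cluster: two radii below `2 * (r * 2 ^ l)`, and `0` at
  -- level `1` by the choice of `r`.
  let D : ℕ → ℝ≥0 := fun j => match j with
    | 0 => 0
    | 1 => 0
    | j + 2 => 4 * (r * 2 ^ (j + 1))
  have hnear : ∀ l a b, F l (τ a) = F l (τ b) → d.dist (τ a) (τ b) ≤ 4 * (r * 2 ^ l) :=
      fun l a b h => by
    have hpos : (0 : ℝ) ≤ r * 2 ^ l := by positivity
    have ha : F l (τ a) ≠ ⊤ := by
      refine ((firstWithin_le (t := a) ?_).trans_lt (WithTop.coe_lt_top _)).ne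
      simp only [dt, d.dist_self, NNReal.coe_zero]
      exact mul_nonneg (by linarith [hβ.1]) hpos
    obtain ⟨t, ht, het⟩ := exists_of_firstWithin_ne_top ha
    obtain ⟨t', ht', het'⟩ := exists_of_firstWithin_ne_top (h ▸ ha)
    have htt : t = t' := g.injective (WithTop.coe_injective (het.symm.trans (h.trans het')))
    subst htt
    have htri : (d.dist (τ a) (τ b) : ℝ) ≤ dt (τ a) t + dt (τ b) t := by
      have := d.dist_triangle (τ a) (τ t) (τ b)
      rw [d.dist_comm (τ t)] at this
      exact_mod_cast this
    have hβ2 : β * (r * 2 ^ l) ≤ 2 * (r * 2 ^ l) := mul_le_mul_of_nonneg_right hβ.2.le hpos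
    rw [← NNReal.coe_le_coe]
    push_cast
    linarith
  have hD : ∀ j a b, E j (τ a) (τ b) → (d.comap τ).dist a b ≤ D j := fun j a b h => by
    change d.dist (τ a) (τ b) ≤ D j
    match j, h with
    | 0, h =>
      have : τ a = τ b := h
      rw [this, d.dist_self]
    | 1, h =>
      have := hnear 0 a b (h 0 le_rfl)
      rw [pow_zero, mul_one] at this
      exact (hrd _ _ this).le
    | j + 2, h => exact hnear (j + 1) a b (h (j + 1) le_rfl)
  obtain ⟨T, f, hT, hf, hw⟩ := exists_tree_of_laminar τ E hE rfl (n + 1) hEn (d.comap τ) D hD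
  choose w hw using hw
  refine ⟨T, f, hT, hf, w, ?_⟩
  have hgeom : ∀ l : ℕ, ∑ j ∈ Finset.range (l + 1), 8 * (r * 2 ^ j) ≤ 16 * (r * 2 ^ l) :=
      fun l => by
    induction l with
    | zero => simp only [zero_add, Finset.sum_range_one]; gcongr; norm_num
    | succ l ih =>
      rw [Finset.sum_range_succ]
      calc _ ≤ 16 * (r * 2 ^ l) + 8 * (r * 2 ^ (l + 1)) := by gcongr
        _ = _ := by ring
  have hpair : ∀ x y, (w x y).semilength (d.comap τ) ≤
      32 * ∑ l ∈ Finset.range n, (if F l x = F l y then 0 else r * 2 ^ l) := fun x y => by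
    refine (hw x y).trans ?_
    rw [show (32 : ℝ≥0) = 2 * 16 by norm_num, mul_assoc]
    gcongr
    rw [Finset.sum_range_succ']
    have h0 : (if E 0 x y then 0 else D (0 + 1)) = 0 := by simp [D]
    rw [h0, add_zero]
    -- A separation at level `j + 1` is charged to some scale `l ≥ j` that cuts the pair. The
    -- charges `8 * (r * 2 ^ j)` to one `l` add up to at most `16 * (r * 2 ^ l)`, and the two halves
    -- of the walk give `32`.
    calc ∑ j ∈ Finset.range n, (if E (j + 1) x y then 0 else D (j + 1 + 1))
        ≤ ∑ j ∈ Finset.range n, ∑ l ∈ Finset.range n,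
            if j ≤ l ∧ F l x ≠ F l y then 8 * (r * 2 ^ j) else 0 := by
          refine Finset.sum_le_sum fun j _ => ?_
          split_ifs with h
          · exact zero_le
          · rw [hEsucc] at h
            push Not at h
            obtain ⟨l, hjl, hl⟩ := h
            have hln : l ∈ Finset.range n := by
              rw [Finset.mem_range]
              by_contra hcon
              exact hl (by rw [hfar l (not_lt.1 hcon), hfar l (not_lt.1 hcon)])
            refine le_trans ?_ (Finset.single_le_sum (f := fun l =>
              if j ≤ l ∧ F l x ≠ F l y then 8 * (r * 2 ^ j) else 0) (fun _ _ => zero_le) hln)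
            rw [if_pos ⟨hjl, hl⟩]
            exact le_of_eq (by simp only [D]; ring)
      _ = ∑ l ∈ Finset.range n, ∑ j ∈ Finset.range n,
            if j ≤ l ∧ F l x ≠ F l y then 8 * (r * 2 ^ j) else 0 := Finset.sum_comm
      _ ≤ ∑ l ∈ Finset.range n, 16 * (if F l x = F l y then 0 else r * 2 ^ l) := by
          refine Finset.sum_le_sum fun l _ => ?_
          by_cases h : F l x = F l y
          · simp [h]
          · simp only [h, ne_eq, not_false_eq_true, and_true, if_false]
            refine le_trans ?_ (hgeom l)
            rw [← Finset.sum_filter]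
            refine Finset.sum_le_sum_of_subset fun j hj => ?_
            simp only [Finset.mem_filter, Finset.mem_range] at hj ⊢
            omega
      _ = _ := by rw [Finset.mul_sum]
  calc ∑ e, c e * (w (u e) (v e)).semilength (d.comap τ)
      ≤ ∑ e, c e * (32 * ∑ l ∈ Finset.range n,
          (if F l (u e) = F l (v e) then 0 else r * 2 ^ l)) := by
        gcongr
        exact hpair _ _
    _ = 32 * ∑ e, c e * ∑ l ∈ Finset.range n,
          (if F l (u e) = F l (v e) then 0 else r * 2 ^ l) := by
        rw [Finset.mul_sum]
        exact Finset.sum_congr rfl fun e _ => by ring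
    _ ≤ _ := by
        gcongr

/-! ### The harmonic bound and the conclusion. -/

/-- The harmonic numbers are `O(log k)` for `k ≥ 2`. -/
theorem sum_inv_le_log {k : ℕ} (hk : 2 ≤ k) :
    ((∑ i ∈ Finset.range k, ((i : ℝ≥0) + 1)⁻¹ : ℝ≥0) : ℝ) ≤ 3 * Real.log k := by
  have h1 := harmonic_le_one_add_log k
  have h2 : ((∑ i ∈ Finset.range k, ((i : ℝ≥0) + 1)⁻¹ : ℝ≥0) : ℝ) = (harmonic k : ℝ) := by
    simp [harmonic]
  have h3 : Real.log 2 ≤ Real.log k := Real.log_le_log (by norm_num) (by exact_mod_cast hk)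
  -- The `1` in `1 + log k` is absorbed since `2 * log k ≥ 2 * log 2 > 1`.
  have h4 := Real.log_two_gt_d9
  rw [h2]
  linarith

/-- There is an absolute constant `A` such that for every graph packing problem on `k ≥ 2` terminals
and every notion of integrality, the worst-case ratio of the integral dual to the
fractional primal over all graphs is at most `A * log k` times the one over trees. -/
theorem mainTheorem3 :
    ∃ A : ℝ, 0 < A ∧ ∀ (K : Type u) [Fintype K], 2 ≤ Fintype.card K →
      ∀ (P : GraphPackingProblem K) (I : IntegralNotion K),
        P.gap I ≤ ENNReal.ofReal (A * Real.log (Fintype.card K)) * P.treeGap I := by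
  -- `96 = 32 * 3`: the routing constant times the harmonic constant.
  refine ⟨96, by norm_num, fun K _ hK P I => ?_⟩
  have : Nonempty K := Fintype.card_pos_iff.1 (by omega)
  have hlog : 0 < Real.log (Fintype.card K) := Real.log_pos (by exact_mod_cast hK)
  by_cases htree : P.treeGap I = ∞
  · rw [htree, ENNReal.mul_top (by simpa using hlog)]
    exact le_top
  refine iSup₂_le fun N c => ?_
  have := N.fintypeV
  by_cases hprimal : P.fracPrimal N c = ∞
  · rw [hprimal, ENNReal.div_top]
    exact zero_le
  obtain ⟨d, hdF, hd⟩ := P.exists_semimetric_of_fracPrimal_ne_top N c hprimal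
  obtain ⟨T, f, hT, hf, w, hw⟩ := exists_tree_routing N.term d (fun e : N.Edge => e.1.out.1)
    (fun e => e.1.out.2) c
  have hF : P.F (d.comap N.term) ≠ 0 := (zero_lt_one.trans_le hdF).ne'
  have hcost : ∑ e : N.Edge, c e * d.dist e.1.out.1 e.1.out.2 = N.cost c d := by
    unfold TermGraph.cost
    refine Finset.sum_congr rfl fun e _ => ?_
    unfold TermGraph.edgeLen
    conv_rhs => rw [← Quot.out_eq e.1]
    rfl
  refine ENNReal.div_le_of_le_mul ?_
  have hdual := P.intDual_le_of_routing I N c d hF T hT f hf htree w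
  rw [hcost] at hw
  have hharm : (32 * ∑ i ∈ Finset.range (Fintype.card K), ((i : ℝ≥0) + 1)⁻¹ : ℝ≥0) ≤
      Real.toNNReal (96 * Real.log (Fintype.card K)) := by
    rw [Real.le_toNNReal_iff_coe_le (by positivity)]
    have := sum_inv_le_log hK
    rw [NNReal.coe_mul, NNReal.coe_ofNat]
    linarith
  have hroute : (∑ e, c e * (w e.1.out.1 e.1.out.2).semilength (d.comap N.term)) /
      P.F (d.comap N.term) ≤ Real.toNNReal (96 * Real.log (Fintype.card K)) * N.cost c d :=
    (div_le_self zero_le hdF).trans (hw.trans (by rw [← mul_assoc]; gcongr))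
  calc P.intDual I N c ≤ P.treeGap I *
        ((Real.toNNReal (96 * Real.log (Fintype.card K)) * N.cost c d : ℝ≥0) : ℝ≥0∞) :=
        hdual.trans (by gcongr)
    _ = ENNReal.ofReal (96 * Real.log (Fintype.card K)) * P.treeGap I * N.cost c d := by
        rw [ENNReal.coe_mul, ENNReal.ofReal]
        ring
    _ ≤ _ := by gcongr
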